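/- Let $n\ge 1$ and let $\Omega\subset\mathbb{R}^n$ be open and bounded (in particular, $\Omega$ may be a convex bounded domain in $\mathbb{R}^2$ or $\mathbb{R}^3$ with $C^{1,1}$ or polygonal boundary). Let $a_{ij},c_0\in L^\infty(\Omega)$, $1\le i,j\le n$, with $c_0\ge 0$ and $a_{ij}=a_{ji}$ a.e. in $\Omega$, and suppose there is $\theta>0$ with $$\sum_{i,j=1}^n a_{ij}(x)\xi_i\xi_j\ge\theta\|\xi\|^2\qquad\text{for a.a. }x\in\Omega\text{ and all }\xi\in\mathbb{R}^n .$$ Let $(Ly)(x)=-\sum_{i,j=1}^n\partial_{x_j}(a_{ij}(x)y_{x_i})+c_0(x)y(x)$. For $f\in L^2(\Omega)$, a function $y\in H^1_0(\Omega)$ is called a weak solution of $Ly=f$ in $\Omega$, $y=0$ on $\partial\Omega$, if $$\int_\Omega\Big(\sum_{i,j=1}^n a_{ji}\,y_{x_i}v_{x_j}+c_0\,y\,v\Big)\,dx=\int_\Omega f\,v\,dx\qquad\text{for all }v\in H^1_0(\Omega).$$ Let $y_d,y_r\in L^2(\Omega)$, let $\alpha,\beta>0$, and let $a,b$ be real numbers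 with $a\le 0\le b$. Consider the problem (P) of minimizing $$J(y,u)=\tfrac12\|y-y_d\|_{L^2(\Omega)}^2+\tfrac{\alpha}{2}\|u\|_{L^2(\Omega)}^2+\beta\|u\|_{L^1(\Omega)}$$ over all $(y,u)\in H^1_0(\Omega)\times L^2(\Omega)$ such that $y$ is the weak solution of $Ly=u+y_r$ in $\Omega$, $y=0$ on $\partial\Omega$, and $a\le u(x)\le b$ for a.a. $x\in\Omega$. **Theorem 2.2 (First-Order Optimality Condition).** A pair $(y^*,u^*)\in H^1_0(\Omega)\times L^2(\Omega)$ is an optimal solution of (P) if and only if there exists an adjoint state $p^*\in H^1_0(\Omega)$ such that 1. $y^*$ is a weak solution of $Ly^*=u^*+y_r$ in $\Omega$, $y^*=0$ on $\partial\Omega$; 2. $p^*$ is a weak solution of $Lp^*=y_d-y^*$ in $\Omega$, $p^*=0$ on $\partial\Omega$; 3. $u^*(x)=\Pi_{[a,b]}\big(\tfrac1\alpha\,\mathrm{soft}(p^*(x),\beta)\big)$ for a.a. $x\in\Omega$, where $\Pi_{[a,b]}(t)=\max\{a,\min\{t,b\}\}$ and $\mathrm{soft}(t,\beta)=\mathrm{sgn}(t)\max(|t|-\beta,0)$.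 -/

import Mathlib

open MeasureTheory
open scoped ENNReal ContDiff

noncomputable section

namespace EllipticControl

/-- The real Hilbert space `L²(Ω)`, for `Ω ⊆ ℝⁿ` with Lebesgue measure. -/
abbrev L2 {n : ℕ} (Ω : Set (EuclideanSpace ℝ (Fin n))) : Type :=
  Lp ℝ 2 (volume.restrict Ω)

/-- The classical partial derivative `∂φ/∂xᵢ`. -/
def partialDeriv {n : ℕ} (i : Fin n) (φ : EuclideanSpace ℝ (Fin n) → ℝ)
    (x : EuclideanSpace ℝ (Fin n)) : ℝ :=
  fderiv ℝ φ x (EuclideanSpace.single i 1)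

/-- `φ ∈ C_c^∞(Ω)`: smooth with compact support contained in `Ω`. -/
structure IsTest {n : ℕ} (Ω : Set (EuclideanSpace ℝ (Fin n)))
    (φ : EuclideanSpace ℝ (Fin n) → ℝ) : Prop where
  smooth : ContDiff ℝ ∞ φ
  compact : HasCompactSupport φ
  support_subset : tsupport φ ⊆ Ω

lemma IsTest.continuous_partialDeriv {n : ℕ} {Ω : Set (EuclideanSpace ℝ (Fin n))}
    {φ : EuclideanSpace ℝ (Fin n) → ℝ} (h : IsTest Ω φ) (i : Fin n) :
    Continuous (partialDeriv i φ) :=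
  (h.smooth.continuous_fderiv (by simp)).clm_apply continuous_const

lemma IsTest.memLp {n : ℕ} {Ω : Set (EuclideanSpace ℝ (Fin n))}
    {φ : EuclideanSpace ℝ (Fin n) → ℝ} (h : IsTest Ω φ) :
    MemLp φ 2 (volume.restrict Ω) :=
  (h.smooth.continuous.memLp_of_hasCompactSupport h.compact).restrict Ω

lemma IsTest.memLp_partialDeriv {n : ℕ} {Ω : Set (EuclideanSpace ℝ (Fin n))}
    {φ : EuclideanSpace ℝ (Fin n) → ℝ} (h : IsTest Ω φ) (i : Fin n) :
    MemLp (partialDeriv i φ) 2 (volume.restrict Ω) :=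
  ((h.continuous_partialDeriv i).memLp_of_hasCompactSupport
    (h.compact.fderiv_apply ℝ (EuclideanSpace.single i 1))).restrict Ω

lemma integrable_L2_mul {n : ℕ} {Ω : Set (EuclideanSpace ℝ (Fin n))} (f : L2 Ω)
    {ψ : EuclideanSpace ℝ (Fin n) → ℝ} (hψ : MemLp ψ 2 (volume.restrict Ω)) :
    Integrable (fun x => f x * ψ x) (volume.restrict Ω) :=
  (Lp.memLp f).integrable_mul hψ

lemma integral_add_L2_mul {n : ℕ} {Ω : Set (EuclideanSpace ℝ (Fin n))} (f g : L2 Ω)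
    {ψ : EuclideanSpace ℝ (Fin n) → ℝ} (hψ : MemLp ψ 2 (volume.restrict Ω)) :
    ∫ x in Ω, (f + g : L2 Ω) x * ψ x = (∫ x in Ω, f x * ψ x) + ∫ x in Ω, g x * ψ x := by
  rw [← integral_add (integrable_L2_mul f hψ) (integrable_L2_mul g hψ)]
  refine integral_congr_ae ?_
  filter_upwards [Lp.coeFn_add f g] with x hx
  rw [hx, Pi.add_apply, add_mul]

lemma integral_smul_L2_mul {n : ℕ} {Ω : Set (EuclideanSpace ℝ (Fin n))} (c : ℝ) (f : L2 Ω)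
    (ψ : EuclideanSpace ℝ (Fin n) → ℝ) :
    ∫ x in Ω, (c • f : L2 Ω) x * ψ x = c * ∫ x in Ω, f x * ψ x := by
  rw [← integral_const_mul]
  refine integral_congr_ae ?_
  filter_upwards [Lp.coeFn_smul c f] with x hx
  rw [hx, Pi.smul_apply, smul_eq_mul, mul_assoc]

lemma integral_zero_L2_mul {n : ℕ} {Ω : Set (EuclideanSpace ℝ (Fin n))}
    (ψ : EuclideanSpace ℝ (Fin n) → ℝ) : ∫ x in Ω, (0 : L2 Ω) x * ψ x = 0 := by
  simpa using integral_smul_L2_mul 0 (0 : L2 Ω) ψ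

/-- The space `H¹(Ω)`. An element is a function `y ∈ L²(Ω)` together with its (unique, when `Ω`
is open) weak gradient `g ∈ L²(Ω)ⁿ`, that is, `∫_Ω y ∂ᵢφ = -∫_Ω gᵢ φ` for all
`φ ∈ C_c^∞(Ω)`. The inherited norm is the Hilbert norm `(‖y‖² + ∑ᵢ ‖gᵢ‖²)^{1/2}`. -/
def H1 {n : ℕ} (Ω : Set (EuclideanSpace ℝ (Fin n))) :
    Submodule ℝ (WithLp 2 (L2 Ω × PiLp 2 (fun _ : Fin n => L2 Ω))) where
  carrier := {w | ∀ φ, IsTest Ω φ → ∀ i : Fin n,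
    ∫ x in Ω, w.fst x * partialDeriv i φ x = -∫ x in Ω, w.snd i x * φ x}
  add_mem' := by
    intro w z hw hz φ hφ i
    have h1 := integral_add_L2_mul w.fst z.fst (hφ.memLp_partialDeriv i)
    have h2 := integral_add_L2_mul (w.snd i) (z.snd i) hφ.memLp
    simp only [WithLp.add_fst, WithLp.add_snd, PiLp.add_apply]
    rw [h1, h2, hw φ hφ i, hz φ hφ i]
    ring
  zero_mem' := by
    intro φ hφ i
    simp only [WithLp.zero_fst, WithLp.zero_snd, PiLp.zero_apply]
    rw [integral_zero_L2_mul, integral_zero_L2_mul, neg_zero]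
  smul_mem' := by
    intro c w hw φ hφ i
    simp only [WithLp.smul_fst, WithLp.smul_snd, PiLp.smul_apply]
    rw [integral_smul_L2_mul, integral_smul_L2_mul, hw φ hφ i]
    ring

/-- The `L²(Ω)` function underlying an element of `H¹(Ω)`. -/
def toL2 {n : ℕ} {Ω : Set (EuclideanSpace ℝ (Fin n))} (y : H1 Ω) : L2 Ω :=
  WithLp.fst (y : WithLp 2 (L2 Ω × PiLp 2 (fun _ : Fin n => L2 Ω)))

/-- The weak partial derivative `y_{xᵢ} ∈ L²(Ω)` of `y ∈ H¹(Ω)`. -/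
def weakDeriv {n : ℕ} {Ω : Set (EuclideanSpace ℝ (Fin n))} (y : H1 Ω) (i : Fin n) : L2 Ω :=
  WithLp.snd (y : WithLp 2 (L2 Ω × PiLp 2 (fun _ : Fin n => L2 Ω))) i

/-- The image of `C_c^∞(Ω)` in `H¹(Ω)`. -/
def testSpace {n : ℕ} (Ω : Set (EuclideanSpace ℝ (Fin n))) : Submodule ℝ (H1 Ω) where
  carrier := {w | ∃ φ, IsTest Ω φ ∧ toL2 w =ᵐ[volume.restrict Ω] φ ∧
    ∀ i, weakDeriv w i =ᵐ[volume.restrict Ω] partialDeriv i φ}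
  add_mem' := by
    rintro w z ⟨φ, hφ, hw, hw'⟩ ⟨ψ, hψ, hz, hz'⟩
    refine ⟨φ + ψ, ⟨hφ.smooth.add hψ.smooth, hφ.compact.add hψ.compact,
      (tsupport_add φ ψ).trans (Set.union_subset hφ.support_subset hψ.support_subset)⟩,
      (Lp.coeFn_add (toL2 w) (toL2 z)).trans (hw.add hz), fun i => ?_⟩
    refine (Lp.coeFn_add (weakDeriv w i) (weakDeriv z i)).trans
      (((hw' i).add (hz' i)).trans (Filter.Eventually.of_forall fun x => ?_))
    have h1 : DifferentiableAt ℝ φ x := hφ.smooth.differentiable (by simp) x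
    have h2 : DifferentiableAt ℝ ψ x := hψ.smooth.differentiable (by simp) x
    simp [partialDeriv, fderiv_add h1 h2]
  zero_mem' := by
    refine ⟨0, ⟨contDiff_const, HasCompactSupport.zero, by simp [tsupport]⟩,
      Lp.coeFn_zero _ _ _, fun i => (Lp.coeFn_zero _ _ _).trans
        (Filter.Eventually.of_forall fun x => ?_)⟩
    simp [partialDeriv]
  smul_mem' := by
    rintro c w ⟨φ, hφ, hw, hw'⟩
    refine ⟨c • φ, ⟨hφ.smooth.const_smul c, hφ.compact.smul_left (f := fun _ => c),
      (closure_mono (Function.support_const_smul_subset c φ)).trans hφ.support_subset⟩,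
      (Lp.coeFn_smul c (toL2 w)).trans (hw.const_smul c), fun i => ?_⟩
    refine (Lp.coeFn_smul c (weakDeriv w i)).trans
      (((hw' i).const_smul c).trans (Filter.Eventually.of_forall fun x => ?_))
    have h1 : DifferentiableAt ℝ φ x := hφ.smooth.differentiable (by simp) x
    simp [partialDeriv, fderiv_const_smul h1]

/-- The space `H¹₀(Ω)`: the closure of `C_c^∞(Ω)` in `H¹(Ω)`. -/
def H10 {n : ℕ} (Ω : Set (EuclideanSpace ℝ (Fin n))) : Submodule ℝ (H1 Ω) :=
  (testSpace Ω).topologicalClosure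

/-- The coefficients of `Ly = -∑ᵢⱼ ∂_{xⱼ}(aᵢⱼ y_{xᵢ}) + c₀ y` are admissible on `Ω`: they are in
`L^∞(Ω)`, `c₀ ≥ 0`, and `(aᵢⱼ)` is symmetric and uniformly elliptic. -/
structure UniformlyElliptic {n : ℕ} (Ω : Set (EuclideanSpace ℝ (Fin n)))
    (A : Fin n → Fin n → EuclideanSpace ℝ (Fin n) → ℝ)
    (c₀ : EuclideanSpace ℝ (Fin n) → ℝ) : Prop where
  memLp_A : ∀ i j, MemLp (A i j) ∞ (volume.restrict Ω)
  memLp_c₀ : MemLp c₀ ∞ (volume.restrict Ω)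
  c₀_nonneg : ∀ᵐ x ∂(volume.restrict Ω), 0 ≤ c₀ x
  symm : ∀ᵐ x ∂(volume.restrict Ω), ∀ i j, A i j x = A j i x
  elliptic : ∃ θ : ℝ, 0 < θ ∧ ∀ᵐ x ∂(volume.restrict Ω), ∀ ξ : EuclideanSpace ℝ (Fin n),
    θ * ‖ξ‖ ^ 2 ≤ ∑ i, ∑ j, A i j x * ξ i * ξ j

/-- The bilinear form `a(y, v) = ∫_Ω (∑ᵢⱼ aⱼᵢ y_{xᵢ} v_{xⱼ} + c₀ y v) dx` of `L`. In the weak form of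
`-∑ᵢⱼ ∂_{xⱼ}(aᵢⱼ y_{xᵢ})` the derivative `∂_{xⱼ}` is moved to the test function; by symmetry
`aᵢⱼ = aⱼᵢ`. -/
def bilin {n : ℕ} {Ω : Set (EuclideanSpace ℝ (Fin n))}
    (A : Fin n → Fin n → EuclideanSpace ℝ (Fin n) → ℝ)
    (c₀ : EuclideanSpace ℝ (Fin n) → ℝ) (y v : H1 Ω) : ℝ :=
  ∫ x in Ω, ((∑ i, ∑ j, A j i x * weakDeriv y i x * weakDeriv v j x) + c₀ x * toL2 y x * toL2 v x)

/-- `y ∈ H¹₀(Ω)` is the weak solution of `Ly = f` in `Ω`, `y = 0` on `∂Ω`. -/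
def IsWeakSolution {n : ℕ} {Ω : Set (EuclideanSpace ℝ (Fin n))}
    (A : Fin n → Fin n → EuclideanSpace ℝ (Fin n) → ℝ)
    (c₀ : EuclideanSpace ℝ (Fin n) → ℝ) (f : L2 Ω) (y : H10 Ω) : Prop :=
  ∀ v : H10 Ω, bilin A c₀ (y : H1 Ω) (v : H1 Ω) = ∫ x in Ω, f x * toL2 (v : H1 Ω) x

/-- The admissible controls `U_ad = {v ∈ L²(Ω) : a ≤ v ≤ b a.e. on Ω}`. -/
def admissible {n : ℕ} (Ω : Set (EuclideanSpace ℝ (Fin n))) (a b : ℝ) : Set (L2 Ω) :=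
  {v | ∀ᵐ x ∂(volume.restrict Ω), a ≤ v x ∧ v x ≤ b}

/-- The feasible pairs: the control is admissible and the state solves `Ly = u + y_r`. -/
def feasible {n : ℕ} {Ω : Set (EuclideanSpace ℝ (Fin n))}
    (A : Fin n → Fin n → EuclideanSpace ℝ (Fin n) → ℝ)
    (c₀ : EuclideanSpace ℝ (Fin n) → ℝ) (y_r : L2 Ω) (a b : ℝ) : Set (H10 Ω × L2 Ω) :=
  {w | IsWeakSolution A c₀ (w.2 + y_r) w.1 ∧ w.2 ∈ admissible Ω a b}

/-- The cost `J(y, u) = ½‖y - y_d‖²_{L²} + (α/2)‖u‖²_{L²} + β‖u‖_{L¹}`. -/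
def cost {n : ℕ} {Ω : Set (EuclideanSpace ℝ (Fin n))} (y_d : L2 Ω) (α β : ℝ)
    (w : H10 Ω × L2 Ω) : ℝ :=
  1 / 2 * ‖toL2 (w.1 : H1 Ω) - y_d‖ ^ 2 + α / 2 * ‖w.2‖ ^ 2 + β * ∫ x in Ω, |w.2 x|

/-- `(y, u)` is an optimal solution of the control problem. -/
def IsOptimal {n : ℕ} {Ω : Set (EuclideanSpace ℝ (Fin n))}
    (A : Fin n → Fin n → EuclideanSpace ℝ (Fin n) → ℝ)
    (c₀ : EuclideanSpace ℝ (Fin n) → ℝ) (y_d y_r : L2 Ω) (a b α β : ℝ)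
    (y : H10 Ω) (u : L2 Ω) : Prop :=
  (y, u) ∈ feasible A c₀ y_r a b ∧ IsMinOn (cost y_d α β) (feasible A c₀ y_r a b) (y, u)

/-- The soft thresholding `soft(t, β) = sgn(t) max(|t| - β, 0)`. -/
def soft (t β : ℝ) : ℝ := Real.sign t * max (|t| - β) 0

/-- The projection `max{a, min{t, b}}` of `t` onto `[a, b]`. -/
def proj (a b t : ℝ) : ℝ := max a (min t b)

end EllipticControl

end

open EllipticControl

/-!
The control problem is convex, and its optimality condition is a variational inequality that
decouples into a one-dimensional minimization at almost every point.

*State equation.* The form `bilin A c₀` is bounded on `H¹(Ω)` (`exists_bilin_eq`), symmetric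
(`bilin_symm`), and coercive on `H¹₀(Ω)` (`exists_bilin_coercive`) by ellipticity and the Poincaré
inequality (`exists_poincare_const`). Lax–Milgram then yields weak solutions for every right-hand
side in `L²(Ω)` (`exists_isWeakSolution`), in particular the adjoint state `p`.

*First-order expansion.* If `h` is a control increment and `z` the state increment it causes, then
by symmetry of the form `⟨y_d - y, z⟩ = ⟨h, p⟩`, so that (`cost_sub_cost`)
`J(y + z, u + h) - J(y, u) = ⟨αu - p, h⟩ + β (‖u + h‖_{L¹} - ‖u‖_{L¹}) + ½‖z‖² + (α/2)‖h‖²`.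
Hence the inequality `⟨αu - p, v - u⟩ + β (‖v‖_{L¹} - ‖u‖_{L¹}) ≥ 0` for all admissible `v` implies
optimality of `u`, and is necessary for it, as one sees by letting the increment tend to zero along
a segment (`IsOptimal.variational_ineq`).

*Pointwise solution.* The number `proj a b (soft p β / α)` satisfies the scalar version of this
inequality (`thresholding_variational_ineq`). Integration shows that a control given by the
thresholding formula satisfies the variational inequality
(`variational_ineq_of_eq_thresholding`), which is the sufficiency. Conversely, with `p` fixed, the
inequality has at most one admissible solution because `u ↦ αu` is strongly monotone, so an optimal
control coincides with the thresholded one.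
-/

namespace EllipticControl

variable {n : ℕ} {Ω : Set (EuclideanSpace ℝ (Fin n))}

/-! ### The Hilbert space `H¹(Ω)` -/

/-- `toL2` as a continuous linear map `H¹(Ω) → L²(Ω)`. -/
noncomputable def toL2L : H1 Ω →L[ℝ] L2 Ω :=
  (WithLp.fstL 2 ℝ (L2 Ω) (PiLp 2 fun _ : Fin n => L2 Ω)).comp (H1 Ω).subtypeL

/-- The weak partial derivative `weakDeriv · i` as a continuous linear map `H¹(Ω) → L²(Ω)`. -/
noncomputable def weakDerivL (i : Fin n) : H1 Ω →L[ℝ] L2 Ω :=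
  ((PiLp.proj 2 (𝕜 := ℝ) (fun _ : Fin n => L2 Ω) i).comp
    (WithLp.sndL 2 ℝ (L2 Ω) (PiLp 2 fun _ : Fin n => L2 Ω))).comp (H1 Ω).subtypeL

@[simp] lemma toL2L_apply (y : H1 Ω) : toL2L y = toL2 y := rfl

@[simp] lemma weakDerivL_apply (i : Fin n) (y : H1 Ω) : weakDerivL i y = weakDeriv y i := rfl

lemma norm_sq_H1 (y : H1 Ω) : ‖y‖ ^ 2 = ‖toL2 y‖ ^ 2 + ∑ i, ‖weakDeriv y i‖ ^ 2 := by
  rw [← Submodule.norm_coe, WithLp.prod_norm_sq_eq_of_L2, PiLp.norm_sq_eq_of_L2]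
  rfl

lemma inner_L2_eq_integral (f g : L2 Ω) : inner ℝ f g = ∫ x in Ω, f x * g x := by
  rw [L2.inner_def]
  exact integral_congr_ae (.of_forall fun x => by simp [mul_comm])

lemma integral_L2_mul_eq_inner (f : L2 Ω) {ψ : EuclideanSpace ℝ (Fin n) → ℝ}
    (hψ : MemLp ψ 2 (volume.restrict Ω)) : ∫ x in Ω, f x * ψ x = inner ℝ f (hψ.toLp ψ) := by
  rw [inner_L2_eq_integral]
  refine integral_congr_ae ?_
  filter_upwards [hψ.coeFn_toLp] with x hx
  rw [hx]

/-- Each condition defining `H¹(Ω)` is an equality of two continuous functionals, so `H¹(Ω)` is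
closed in `L²(Ω) × L²(Ω)ⁿ`. -/
lemma isClosed_H1 :
    IsClosed (H1 Ω : Set (WithLp 2 (L2 Ω × PiLp 2 (fun _ : Fin n => L2 Ω)))) := by
  have : (H1 Ω : Set (WithLp 2 (L2 Ω × PiLp 2 (fun _ : Fin n => L2 Ω)))) =
      ⋂ (φ) (hφ : IsTest Ω φ) (i : Fin n),
        {w | inner ℝ w.fst ((hφ.memLp_partialDeriv i).toLp _) =
          -inner ℝ (w.snd i) (hφ.memLp.toLp φ)} := by
    ext w
    simp only [Set.mem_iInter, Set.mem_ofPred_eq, ← integral_L2_mul_eq_inner]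
    rfl
  rw [this]
  refine isClosed_iInter fun φ => isClosed_iInter fun hφ => isClosed_iInter fun i =>
    isClosed_eq ?_ ?_ <;> fun_prop

instance : CompleteSpace (H1 Ω) := isClosed_H1.completeSpace_coe

/-! ### The Poincaré inequality -/

/-- The identity behind the Poincaré inequality: integrate by parts in
`∫ φ² = ∫ (∂ᵢxᵢ) φ² = -∫ xᵢ ∂ᵢ(φ²)`. -/
lemma IsTest.integral_sq_eq {φ : EuclideanSpace ℝ (Fin n) → ℝ} (h : IsTest Ω φ) (i : Fin n) :
    ∫ x, φ x ^ 2 = -2 * ∫ x : EuclideanSpace ℝ (Fin n), x i * φ x * partialDeriv i φ x := by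
  have hd : Differentiable ℝ φ := h.smooth.differentiable (by simp)
  have hc := h.smooth.continuous
  have hcd := h.continuous_partialDeriv i
  have hcoord : ∀ x : EuclideanSpace ℝ (Fin n),
      HasFDerivAt (fun x : EuclideanSpace ℝ (Fin n) => x i)
        (EuclideanSpace.proj i : EuclideanSpace ℝ (Fin n) →L[ℝ] ℝ) x := fun x =>
    (EuclideanSpace.proj i : EuclideanSpace ℝ (Fin n) →L[ℝ] ℝ).hasFDerivAt
  have hfd : ∀ x : EuclideanSpace ℝ (Fin n),
      fderiv ℝ (fun x => x i) x (EuclideanSpace.single i 1) = 1 := fun x => by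
    rw [(hcoord x).fderiv]; simp
  have hsq : ∀ x, fderiv ℝ (fun x => φ x ^ 2) x (EuclideanSpace.single i 1) =
      2 * (φ x * partialDeriv i φ x) := fun x => by
    rw [((hd x).hasFDerivAt.pow 2).fderiv]
    simp [partialDeriv]; ring
  have hcs : ∀ g : EuclideanSpace ℝ (Fin n) → ℝ, Continuous g →
      Integrable fun x => g x * φ x := fun g hg =>
    (hg.mul hc).integrable_of_hasCompactSupport h.compact.mul_left
  have := integral_mul_fderiv_eq_neg_fderiv_mul_of_integrable (𝕜 := ℝ) (μ := volume)
    (f := fun x : EuclideanSpace ℝ (Fin n) => x i) (g := fun x => φ x ^ 2)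
    (v := EuclideanSpace.single i 1)
    (by simpa only [hfd, one_mul, sq] using hcs φ hc)
    (by
      simp only [hsq]
      refine (hcs (fun x => x i * (2 * partialDeriv i φ x)) (by fun_prop)).congr
        (.of_forall fun x => ?_)
      ring)
    (by
      refine (hcs (fun x => x i * φ x) (by fun_prop)).congr (.of_forall fun x => ?_)
      ring)
    (fun x _ => (hcoord x).differentiableAt) (fun x _ => (hd x).pow 2)
  simp only [hfd, hsq, one_mul] at this
  rw [← integral_const_mul, ← neg_eq_iff_eq_neg.mpr this, ← integral_neg]
  exact integral_congr_ae (.of_forall fun x => by ring)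

/-- The Poincaré inequality on `H¹₀(Ω)` for bounded `Ω`, in terms of a single partial derivative:
if `|x| ≤ R` on `Ω`, the constant `2R` works for test functions, hence by density on `H¹₀(Ω)`. -/
lemma exists_poincare_const (hΩb : Bornology.IsBounded Ω) (i : Fin n) :
    ∃ C : ℝ, 0 ≤ C ∧ ∀ v : H10 Ω, ‖toL2 (v : H1 Ω)‖ ≤ C * ‖weakDeriv (v : H1 Ω) i‖ := by
  obtain ⟨R, hR⟩ := hΩb.exists_norm_le
  -- `R` may be negative when `Ω` is empty.
  have hR0 : 0 ≤ max R 0 := le_max_right _ _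
  refine ⟨2 * max R 0, by positivity, fun v => ?_⟩
  have hcl : IsClosed {w : H1 Ω | ‖toL2L w‖ ≤ 2 * max R 0 * ‖weakDerivL i w‖} :=
    isClosed_le (by fun_prop) (by fun_prop)
  refine closure_minimal (s := (testSpace Ω : Set (H1 Ω))) ?_ hcl v.2
  rintro w ⟨φ, hφ, hw, hw'⟩
  simp only [Set.mem_ofPred_eq, toL2L_apply, weakDerivL_apply]
  have hz : ∀ x, x ∉ Ω → φ x = 0 := fun x hx =>
    image_eq_zero_of_notMem_tsupport fun h => hx (hφ.support_subset h)
  have h1 : ‖toL2 w‖ ^ 2 = ∫ x, φ x ^ 2 := by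
    rw [← real_inner_self_eq_norm_sq, inner_L2_eq_integral,
      ← setIntegral_eq_integral_of_forall_compl_eq_zero (s := Ω) (f := fun x => φ x ^ 2)
        fun x hx => by simp [hz x hx]]
    refine integral_congr_ae ?_
    filter_upwards [hw] with x hx
    rw [hx, sq]
  have h2 : |∫ x : EuclideanSpace ℝ (Fin n), x i * φ x * partialDeriv i φ x| ≤
      max R 0 * (‖toL2 w‖ * ‖weakDeriv w i‖) := by
    rw [← setIntegral_eq_integral_of_forall_compl_eq_zero (s := Ω)
      (f := fun x : EuclideanSpace ℝ (Fin n) => x i * φ x * partialDeriv i φ x)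
      fun x hx => by simp [hz x hx]]
    calc |∫ x in Ω, x i * φ x * partialDeriv i φ x|
        ≤ ∫ x in Ω, max R 0 * (|toL2 w| x * |weakDeriv w i| x) := by
          refine norm_integral_le_of_norm_le (f := fun x => x i * φ x * partialDeriv i φ x)
            ((integrable_L2_mul _ (Lp.memLp _)).const_mul _) ?_
          filter_upwards [hw, hw' i, Lp.coeFn_abs (toL2 w), Lp.coeFn_abs (weakDeriv w i)]
            with x h1 h2 h3 h4
          rw [h3, h4, h1, h2, norm_mul, norm_mul, mul_assoc]
          by_cases hx : x ∈ Ω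
          · have : ‖x i‖ ≤ max R 0 :=
              (PiLp.norm_apply_le x i).trans ((hR x hx).trans (le_max_left _ _))
            simp only [Real.norm_eq_abs] at this ⊢
            gcongr
          · simp [hz x hx]
      _ = max R 0 * inner ℝ |toL2 w| |weakDeriv w i| := by
          rw [integral_const_mul, inner_L2_eq_integral]
      _ ≤ _ := by
          gcongr
          exact (real_inner_le_norm _ _).trans_eq (by rw [norm_abs_eq_norm, norm_abs_eq_norm])
  rw [hφ.integral_sq_eq i] at h1
  by_contra! hlt
  have := (abs_le.mp h2).1
  have h0 : 0 < ‖toL2 w‖ := lt_of_le_of_lt (by positivity) hlt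
  nlinarith

/-! ### The bilinear form -/

/-- Multiplication by an `L^∞(Ω)` function as a bounded operator on `L²(Ω)`. -/
noncomputable def mulL (m : Lp ℝ ∞ (volume.restrict Ω)) : L2 Ω →L[ℝ] L2 Ω :=
  (ContinuousLinearMap.mul ℝ ℝ).holderL (volume.restrict Ω) ∞ 2 2 m

lemma coeFn_mulL {m : EuclideanSpace ℝ (Fin n) → ℝ} (hm : MemLp m ∞ (volume.restrict Ω))
    (f : L2 Ω) : mulL (hm.toLp m) f =ᵐ[volume.restrict Ω] fun x => m x * f x := by
  filter_upwards [(ContinuousLinearMap.mul ℝ ℝ).coeFn_holder (r := 2) (hm.toLp m) f,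
    hm.coeFn_toLp] with x hx hx'
  rw [← hx']
  exact hx

lemma integrable_mul_mul {m : EuclideanSpace ℝ (Fin n) → ℝ} (hm : MemLp m ∞ (volume.restrict Ω))
    (f g : L2 Ω) : Integrable (fun x => m x * f x * g x) (volume.restrict Ω) := by
  refine (integrable_L2_mul (mulL (hm.toLp m) f) (Lp.memLp g)).congr ?_
  filter_upwards [coeFn_mulL hm f] with x hx
  rw [hx]

/-- The pairing `(f, g) ↦ ∫_Ω f g` on `L²(Ω)` as a continuous bilinear map. It is the inner product,
but linear in the first argument without the conjugation of `innerSL`. -/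
noncomputable def L2pairing : L2 Ω →L[ℝ] L2 Ω →L[ℝ] ℝ :=
  (ContinuousLinearMap.mul ℝ ℝ).lpPairing (volume.restrict Ω) 2 2

lemma L2pairing_mulL {m : EuclideanSpace ℝ (Fin n) → ℝ} (hm : MemLp m ∞ (volume.restrict Ω))
    (f g : L2 Ω) : L2pairing (mulL (hm.toLp m) f) g = ∫ x in Ω, m x * f x * g x := by
  refine ((ContinuousLinearMap.mul ℝ ℝ).lpPairing_eq_integral _ _).trans (integral_congr_ae ?_)
  filter_upwards [coeFn_mulL hm f] with x hx
  simp [hx]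

variable {A : Fin n → Fin n → EuclideanSpace ℝ (Fin n) → ℝ}
  {c₀ : EuclideanSpace ℝ (Fin n) → ℝ}

lemma bilin_eq_sum (hL : UniformlyElliptic Ω A c₀) (y v : H1 Ω) :
    bilin A c₀ y v = (∑ i, ∑ j, ∫ x in Ω, A j i x * weakDeriv y i x * weakDeriv v j x) +
      ∫ x in Ω, c₀ x * toL2 y x * toL2 v x := by
  have h : ∀ i j, Integrable (fun x => A j i x * weakDeriv y i x * weakDeriv v j x)
      (volume.restrict Ω) := fun i j => integrable_mul_mul (hL.memLp_A j i) _ _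
  rw [bilin, integral_add
    (integrable_finsetSum _ fun i _ => integrable_finsetSum _ fun j _ => h i j)
    (integrable_mul_mul hL.memLp_c₀ _ _), integral_finsetSum _ fun i _ =>
      integrable_finsetSum _ fun j _ => h i j]
  simp_rw [integral_finsetSum _ fun j _ => h _ j]

/-- The form `bilin A c₀` is a bounded bilinear form on `H¹(Ω)`. -/
lemma exists_bilin_eq (hL : UniformlyElliptic Ω A c₀) :
    ∃ B : H1 Ω →L[ℝ] H1 Ω →L[ℝ] ℝ, ∀ y v, bilin A c₀ y v = B y v := by
  refine ⟨(∑ i, ∑ j, L2pairing.bilinearComp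
      ((mulL ((hL.memLp_A j i).toLp _)).comp (weakDerivL i)) (weakDerivL j)) +
    L2pairing.bilinearComp ((mulL (hL.memLp_c₀.toLp _)).comp toL2L) toL2L, fun y v => ?_⟩
  rw [bilin_eq_sum hL]
  simp [L2pairing_mulL]

lemma bilin_symm (hL : UniformlyElliptic Ω A c₀) (y v : H1 Ω) :
    bilin A c₀ y v = bilin A c₀ v y := by
  refine integral_congr_ae ?_
  filter_upwards [hL.symm] with x hx
  rw [Finset.sum_comm]
  congr 1
  · refine Finset.sum_congr rfl fun i _ => Finset.sum_congr rfl fun j _ => ?_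
    rw [hx i j]; ring
  · ring

/-- The form is coercive on `H¹₀(Ω)`: ellipticity and `c₀ ≥ 0` bound it below by the norm of the
gradient, and the Poincaré inequality controls the remaining part of the `H¹` norm. -/
lemma exists_bilin_coercive (hn : 1 ≤ n) (hΩb : Bornology.IsBounded Ω)
    (hL : UniformlyElliptic Ω A c₀) :
    ∃ c : ℝ, 0 < c ∧ ∀ v ∈ H10 Ω, c * ‖v‖ * ‖v‖ ≤ bilin A c₀ v v := by
  obtain ⟨θ, hθ, hell⟩ := hL.elliptic
  obtain ⟨C, hC, hP⟩ := exists_poincare_const hΩb (⟨0, hn⟩ : Fin n)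
  have hlow : ∀ v : H1 Ω, θ * ∑ i, ‖weakDeriv v i‖ ^ 2 ≤ bilin A c₀ v v := by
    intro v
    have hint : ∀ i, Integrable (fun x => weakDeriv v i x * weakDeriv v i x)
        (volume.restrict Ω) := fun i => integrable_L2_mul _ (Lp.memLp _)
    simp_rw [← real_inner_self_eq_norm_sq, inner_L2_eq_integral]
    rw [← integral_finsetSum _ fun i _ => hint i, ← integral_const_mul]
    refine integral_mono_ae ((integrable_finsetSum _ fun i _ => hint i).const_mul θ)
      ((integrable_finsetSum _ fun i _ => integrable_finsetSum _ fun j _ =>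
        integrable_mul_mul (hL.memLp_A j i) _ _).add (integrable_mul_mul hL.memLp_c₀ _ _)) ?_
    filter_upwards [hell, hL.c₀_nonneg] with x hx hx0
    -- Ellipticity at `ξ = ∇v(x)`.
    have h := hx (WithLp.toLp 2 fun i => weakDeriv v i x)
    rw [EuclideanSpace.real_norm_sq_eq] at h
    rw [Finset.sum_comm]
    have h' : 0 ≤ c₀ x * toL2 v x * toL2 v x := by
      rw [mul_assoc]; exact mul_nonneg hx0 (mul_self_nonneg _)
    have e1 : ∑ i, weakDeriv v i x * weakDeriv v i x = ∑ i, weakDeriv v i x ^ 2 := by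
      simp_rw [sq]
    have e2 : ∑ i, ∑ j, A i j x * weakDeriv v j x * weakDeriv v i x =
        ∑ i, ∑ j, A i j x * weakDeriv v i x * weakDeriv v j x := by
      simp_rw [mul_right_comm]
    rw [e1, e2]
    exact h.trans (le_add_of_nonneg_right h')
  refine ⟨θ / (C ^ 2 + 1), by positivity, fun v hv => ?_⟩
  have h0 : ‖weakDeriv v ⟨0, hn⟩‖ ^ 2 ≤ ∑ i, ‖weakDeriv v i‖ ^ 2 :=
    Finset.single_le_sum (f := fun i => ‖weakDeriv v i‖ ^ 2)
      (fun i _ => by positivity) (Finset.mem_univ _)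
  have h1 : ‖toL2 v‖ ^ 2 ≤ C ^ 2 * ∑ i, ‖weakDeriv v i‖ ^ 2 := by
    calc ‖toL2 v‖ ^ 2 ≤ (C * ‖weakDeriv v ⟨0, hn⟩‖) ^ 2 := by
          gcongr; exact hP ⟨v, hv⟩
      _ ≤ _ := by rw [mul_pow]; gcongr
  have h2 : ‖v‖ ^ 2 ≤ (C ^ 2 + 1) * ∑ i, ‖weakDeriv v i‖ ^ 2 := by
    rw [norm_sq_H1]; linarith
  calc θ / (C ^ 2 + 1) * ‖v‖ * ‖v‖ = θ / (C ^ 2 + 1) * ‖v‖ ^ 2 := by ring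
    _ ≤ θ / (C ^ 2 + 1) * ((C ^ 2 + 1) * ∑ i, ‖weakDeriv v i‖ ^ 2) := by gcongr
    _ = θ * ∑ i, ‖weakDeriv v i‖ ^ 2 := by field_simp
    _ ≤ _ := hlow v

/-! ### Existence of weak solutions -/

/-- The Lax–Milgram theorem on a closed subspace `K` of a Hilbert space: only coercivity on `K` is
needed. -/
lemma exists_mem_forall_eq_of_coercive {V : Type*} [NormedAddCommGroup V] [InnerProductSpace ℝ V]
    [CompleteSpace V] {K : Submodule ℝ V} (hK : IsClosed (K : Set V)) (B : V →L[ℝ] V →L[ℝ] ℝ)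
    {c : ℝ} (hc : 0 < c) (hcoer : ∀ v ∈ K, c * ‖v‖ * ‖v‖ ≤ B v v) (ℓ : V →L[ℝ] ℝ) :
    ∃ y ∈ K, ∀ v ∈ K, B y v = ℓ v := by
  have : CompleteSpace K := hK.completeSpace_coe
  let B₀ : K →L[ℝ] K →L[ℝ] ℝ := B.bilinearComp K.subtypeL K.subtypeL
  have hB₀ : IsCoercive B₀ := ⟨c, hc, fun v => hcoer v v.2⟩
  let r : K := (InnerProductSpace.toDual ℝ K).symm (ℓ.comp K.subtypeL)
  refine ⟨hB₀.continuousLinearEquivOfBilin.symm r, SetLike.coe_mem _, fun v hv => ?_⟩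
  calc B₀ (hB₀.continuousLinearEquivOfBilin.symm r) ⟨v, hv⟩ = inner ℝ r ⟨v, hv⟩ := by
        rw [← hB₀.continuousLinearEquivOfBilin_apply, ContinuousLinearEquiv.apply_symm_apply]
    _ = ℓ v := InnerProductSpace.toDual_symm_apply

lemma exists_isWeakSolution (hn : 1 ≤ n) (hΩb : Bornology.IsBounded Ω)
    (hL : UniformlyElliptic Ω A c₀) (f : L2 Ω) : ∃ y : H10 Ω, IsWeakSolution A c₀ f y := by
  obtain ⟨B, hB⟩ := exists_bilin_eq hL
  obtain ⟨c, hc, hcoer⟩ := exists_bilin_coercive hn hΩb hL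
  have hcl : IsClosed (H10 Ω : Set (H1 Ω)) := Submodule.isClosed_topologicalClosure (testSpace Ω)
  have hB' : ∀ v ∈ H10 Ω, c * ‖v‖ * ‖v‖ ≤ B v v := fun v hv => (hcoer v hv).trans_eq (hB v v)
  let ℓ : H1 Ω →L[ℝ] ℝ := (innerSL ℝ f).comp toL2L
  obtain ⟨y, hyK, hy⟩ := exists_mem_forall_eq_of_coercive (V := H1 Ω) (K := H10 Ω) hcl B hc hB' ℓ
  refine ⟨⟨y, hyK⟩, fun v => ?_⟩
  rw [hB, ← inner_L2_eq_integral]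
  exact hy v v.2

/-! ### Weak solutions and the cost -/

lemma isWeakSolution_iff_inner {f : L2 Ω} {y : H10 Ω} : IsWeakSolution A c₀ f y ↔
    ∀ v : H10 Ω, bilin A c₀ (y : H1 Ω) (v : H1 Ω) = inner ℝ f (toL2 (v : H1 Ω)) := by
  simp_rw [inner_L2_eq_integral]; rfl

lemma IsWeakSolution.add (hL : UniformlyElliptic Ω A c₀) {f g : L2 Ω} {y z : H10 Ω}
    (hy : IsWeakSolution A c₀ f y) (hz : IsWeakSolution A c₀ g z) :
    IsWeakSolution A c₀ (f + g) (y + z) := by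
  obtain ⟨B, hB⟩ := exists_bilin_eq hL
  rw [isWeakSolution_iff_inner] at *
  simp only [hB] at *
  intro v
  rw [Submodule.coe_add, map_add, add_apply, hy, hz, inner_add_left]

lemma IsWeakSolution.sub (hL : UniformlyElliptic Ω A c₀) {f g : L2 Ω} {y z : H10 Ω}
    (hy : IsWeakSolution A c₀ f y) (hz : IsWeakSolution A c₀ g z) :
    IsWeakSolution A c₀ (f - g) (y - z) := by
  obtain ⟨B, hB⟩ := exists_bilin_eq hL
  rw [isWeakSolution_iff_inner] at *
  simp only [hB] at *
  intro v
  rw [Submodule.coe_sub, map_sub, sub_apply, hy, hz, inner_sub_left]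

lemma IsWeakSolution.smul (hL : UniformlyElliptic Ω A c₀) (t : ℝ) {f : L2 Ω} {y : H10 Ω}
    (hy : IsWeakSolution A c₀ f y) : IsWeakSolution A c₀ (t • f) (t • y) := by
  obtain ⟨B, hB⟩ := exists_bilin_eq hL
  rw [isWeakSolution_iff_inner] at *
  simp only [hB] at *
  intro v
  rw [Submodule.coe_smul, map_smul, smul_apply, hy, real_inner_smul_left,
    smul_eq_mul]

/-- The solution operator of `L` is self-adjoint, because the bilinear form is symmetric: this is
what makes the solution `p` of the adjoint equation represent the derivative of the cost. -/
lemma IsWeakSolution.inner_comm (hL : UniformlyElliptic Ω A c₀) {f g : L2 Ω} {p z : H10 Ω}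
    (hp : IsWeakSolution A c₀ g p) (hz : IsWeakSolution A c₀ f z) :
    inner ℝ g (toL2 (z : H1 Ω)) = inner ℝ f (toL2 (p : H1 Ω)) := by
  rw [isWeakSolution_iff_inner] at hp hz
  rw [← hp z, ← hz p, bilin_symm hL]

/-- The exact expansion of the cost along a control increment `h` and the corresponding state
increment `z`: the adjoint state turns the first-order term in `z` into one in `h`, the nonsmooth
term is kept as it is, and the remainder is quadratic and nonnegative. -/
lemma cost_sub_cost (hL : UniformlyElliptic Ω A c₀) {y_d : L2 Ω} (α β : ℝ)
    {y p z : H10 Ω} {u h : L2 Ω}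
    (hp : IsWeakSolution A c₀ (y_d - toL2 (y : H1 Ω)) p) (hz : IsWeakSolution A c₀ h z) :
    cost y_d α β (y + z, u + h) - cost y_d α β (y, u) =
      inner ℝ (α • u - toL2 (p : H1 Ω)) h +
        β * ((∫ x in Ω, |(u + h : L2 Ω) x|) - ∫ x in Ω, |u x|) +
        (1 / 2 * ‖toL2 (z : H1 Ω)‖ ^ 2 + α / 2 * ‖h‖ ^ 2) := by
  have h1 := hp.inner_comm hL hz
  have h2 : toL2 ((y + z : H10 Ω) : H1 Ω) - y_d =
      toL2 (z : H1 Ω) - (y_d - toL2 (y : H1 Ω)) := by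
    change toL2L ((y : H1 Ω) + (z : H1 Ω)) - y_d = _
    rw [map_add]; simp only [toL2L_apply]; abel
  have h3 : ‖toL2 (y : H1 Ω) - y_d‖ = ‖y_d - toL2 (y : H1 Ω)‖ := norm_sub_rev _ _
  simp only [cost]
  rw [h2, h3, norm_sub_sq_real, norm_add_sq_real, inner_sub_left, real_inner_smul_left,
    real_inner_comm _ (toL2 (z : H1 Ω)), h1,
    real_inner_comm h (toL2 (p : H1 Ω)), real_inner_comm h u]
  ring

/-! ### The projected soft thresholding -/

/-- The point `s = proj a b (soft p β / α)` satisfies the variational inequality of the convex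
function `t ↦ α / 2 * t ^ 2 - p * t + β * |t|` on `[a, b]`, hence is its minimizer. -/
lemma thresholding_variational_ineq {a b α β : ℝ} (ha : a ≤ 0) (hb : 0 ≤ b) (hα : 0 < α)
    (hβ : 0 < β) (p : ℝ) {t : ℝ} (ht : a ≤ t ∧ t ≤ b) :
    0 ≤ (α * proj a b (1 / α * soft p β) - p) * (t - proj a b (1 / α * soft p β)) +
      β * (|t| - |proj a b (1 / α * soft p β)|) := by
  obtain ⟨hat, htb⟩ := ht
  rcases lt_or_ge β |p| with h | h
  · rcases lt_abs.mp h with hp | hp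
    · have hs : soft p β = p - β := by
        have : 0 < p := hβ.trans hp
        rw [soft, Real.sign_of_pos this, abs_of_pos this, max_eq_left (by linarith), one_mul]
      have hs0 : 0 ≤ 1 / α * (p - β) := by have := sub_pos.2 hp; positivity
      have hαs : α * (1 / α * (p - β)) = p - β := by field_simp
      rw [hs, proj, max_eq_right (ha.trans (le_min hs0 hb)), abs_of_nonneg (le_min hs0 hb)]
      have := le_abs_self t
      rcases le_total (1 / α * (p - β)) b with h' | h'
      · rw [min_eq_left h', hαs]; nlinarith
      · have := mul_le_mul_of_nonneg_left h' hα.le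
        rw [min_eq_right h']; nlinarith
    · have hs : soft p β = -(-p - β) := by
        have : p < 0 := by linarith
        rw [soft, Real.sign_of_neg this, abs_of_neg this, max_eq_left (by linarith), neg_one_mul]
      have hs0 : 1 / α * -(-p - β) ≤ 0 :=
        mul_nonpos_of_nonneg_of_nonpos (by positivity) (by linarith)
      have hαs : α * (1 / α * -(-p - β)) = -(-p - β) := by field_simp
      rw [hs, proj, min_eq_left (hs0.trans hb), abs_of_nonpos (max_le ha hs0)]
      have := neg_le_abs t
      rcases le_total (1 / α * -(-p - β)) a with h' | h'
      · have := mul_le_mul_of_nonneg_left h' hα.le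
        rw [max_eq_left h']; nlinarith
      · rw [max_eq_right h', hαs]; nlinarith
  · have hs : soft p β = 0 := by rw [soft, max_eq_right (by linarith), mul_zero]
    rw [hs, mul_zero, proj, min_eq_left hb, max_eq_right ha]
    have : p * t ≤ β * |t| := (le_abs_self _).trans ((abs_mul p t).trans_le (by gcongr))
    simp only [abs_zero]; linarith

lemma proj_mem_Icc {a b : ℝ} (h : a ≤ b) (t : ℝ) : a ≤ proj a b t ∧ proj a b t ≤ b :=
  ⟨le_max_left _ _, max_le h (min_le_right _ _)⟩

lemma measurable_sign : Measurable Real.sign := by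
  unfold Real.sign
  exact Measurable.ite measurableSet_Iio measurable_const
    (Measurable.ite measurableSet_Ioi measurable_const measurable_const)

lemma measurable_proj_soft (a b α β : ℝ) :
    Measurable fun t => proj a b (1 / α * soft t β) := by
  have := measurable_sign
  unfold proj soft
  fun_prop

lemma integrable_abs_L2 (hΩb : Bornology.IsBounded Ω) (u : L2 Ω) :
    Integrable (fun x => |u x|) (volume.restrict Ω) := by
  have : IsFiniteMeasure (volume.restrict Ω) := ⟨by simpa using hΩb.measure_lt_top⟩
  exact ((Lp.memLp u).integrable (by norm_num)).abs

lemma variational_ineq_of_eq_thresholding (hΩb : Bornology.IsBounded Ω) {a b α β : ℝ}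
    (ha : a ≤ 0) (hb : 0 ≤ b) (hα : 0 < α) (hβ : 0 < β) {p u v : L2 Ω}
    (hu : ∀ᵐ x ∂(volume.restrict Ω), u x = proj a b (1 / α * soft (p x) β))
    (hv : v ∈ admissible Ω a b) :
    0 ≤ inner ℝ (α • u - p) (v - u) + β * ((∫ x in Ω, |v x|) - ∫ x in Ω, |u x|) := by
  have h1 := integrable_L2_mul (α • u - p) (Lp.memLp (v - u))
  have h2 : Integrable (fun x => β * (|v x| - |u x|)) (volume.restrict Ω) :=
    ((integrable_abs_L2 hΩb v).sub (integrable_abs_L2 hΩb u)).const_mul β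
  rw [inner_L2_eq_integral, ← integral_sub (integrable_abs_L2 hΩb v) (integrable_abs_L2 hΩb u),
    ← integral_const_mul, ← integral_add h1 h2]
  refine integral_nonneg_of_ae ?_
  filter_upwards [hu, hv, Lp.coeFn_sub (α • u) p, Lp.coeFn_smul α u, Lp.coeFn_sub v u]
    with x hx hvx e1 e2 e3
  rw [e1, e3, Pi.sub_apply, Pi.sub_apply, e2, Pi.smul_apply, smul_eq_mul, hx]
  exact thresholding_variational_ineq ha hb hα hβ (p x) hvx

lemma exists_admissible_eq_thresholding (hΩb : Bornology.IsBounded Ω) {a b : ℝ} (hab : a ≤ b)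
    (α β : ℝ) (p : L2 Ω) : ∃ v ∈ admissible Ω a b,
      ∀ᵐ x ∂(volume.restrict Ω), v x = proj a b (1 / α * soft (p x) β) := by
  have : IsFiniteMeasure (volume.restrict Ω) := ⟨by simpa using hΩb.measure_lt_top⟩
  have hmem : MemLp (fun x => proj a b (1 / α * soft (p x) β)) 2 (volume.restrict Ω) := by
    refine MemLp.of_bound ((measurable_proj_soft a b α β).comp_aemeasurable
      (Lp.aestronglyMeasurable p).aemeasurable).aestronglyMeasurable (max |a| |b|)
      (.of_forall fun x => ?_)
    exact abs_le_max_abs_abs (proj_mem_Icc hab _).1 (proj_mem_Icc hab _).2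
  refine ⟨hmem.toLp _, ?_, hmem.coeFn_toLp⟩
  filter_upwards [hmem.coeFn_toLp] with x hx
  rw [hx]
  exact proj_mem_Icc hab _

/-! ### The optimality condition -/

/-- An optimal control satisfies the variational inequality with the adjoint state: this is the
limit `t → 0⁺` of `0 ≤ (J(u + t(v - u)) - J(u)) / t`, where convexity bounds the difference of the
`L¹` norms by `t (‖v‖_{L¹} - ‖u‖_{L¹})`. -/
lemma IsOptimal.variational_ineq (hn : 1 ≤ n) (hΩb : Bornology.IsBounded Ω)
    (hL : UniformlyElliptic Ω A c₀) {y_d y_r : L2 Ω} {a b α β : ℝ} (hβ : 0 < β)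
    {y p : H10 Ω} {u v : L2 Ω} (hopt : IsOptimal A c₀ y_d y_r a b α β y u)
    (hp : IsWeakSolution A c₀ (y_d - toL2 (y : H1 Ω)) p) (hv : v ∈ admissible Ω a b) :
    0 ≤ inner ℝ (α • u - toL2 (p : H1 Ω)) (v - u) +
      β * ((∫ x in Ω, |v x|) - ∫ x in Ω, |u x|) := by
  obtain ⟨⟨hy, hu⟩, hmin⟩ := hopt
  obtain ⟨z, hz⟩ := exists_isWeakSolution hn hΩb hL (v - u)
  set X := inner ℝ (α • u - toL2 (p : H1 Ω)) (v - u) +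
      β * ((∫ x in Ω, |v x|) - ∫ x in Ω, |u x|) with hX
  set Y := 1 / 2 * ‖toL2 (z : H1 Ω)‖ ^ 2 + α / 2 * ‖v - u‖ ^ 2 with hY
  have key : ∀ t : ℝ, 0 < t → t ≤ 1 → 0 ≤ X + t * Y := by
    intro t ht0 ht1
    have hcoe : ∀ᵐ x ∂(volume.restrict Ω),
        (u + t • (v - u) : L2 Ω) x = (1 - t) * u x + t * v x := by
      filter_upwards [Lp.coeFn_add u (t • (v - u)), Lp.coeFn_smul t (v - u), Lp.coeFn_sub v u]
        with x e1 e2 e3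
      rw [e1, Pi.add_apply, e2, Pi.smul_apply, e3, Pi.sub_apply, smul_eq_mul]; ring
    have hadm : u + t • (v - u) ∈ admissible Ω a b := by
      have hu : ∀ᵐ x ∂(volume.restrict Ω), a ≤ u x ∧ u x ≤ b := hu
      change ∀ᵐ x ∂(volume.restrict Ω), _
      filter_upwards [hcoe, hu, hv] with x hx hux hvx
      rw [hx]
      constructor <;> nlinarith
    have hst : IsWeakSolution A c₀ (u + t • (v - u) + y_r) (y + t • z) := by
      have := hy.add hL (hz.smul hL t)
      rwa [add_right_comm] at this
    have hJ : cost y_d α β (y, u) ≤ cost y_d α β (y + t • z, u + t • (v - u)) :=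
      hmin (show (y + t • z, u + t • (v - u)) ∈ feasible A c₀ y_r a b from ⟨hst, hadm⟩)
    have hdiff := cost_sub_cost hL α β (u := u) hp (hz.smul hL t)
    have hconv : (∫ x in Ω, |(u + t • (v - u) : L2 Ω) x|) ≤
        (1 - t) * (∫ x in Ω, |u x|) + t * ∫ x in Ω, |v x| := by
      rw [← integral_const_mul, ← integral_const_mul, ← integral_add
        ((integrable_abs_L2 hΩb u).const_mul _) ((integrable_abs_L2 hΩb v).const_mul _)]
      refine integral_mono_ae (integrable_abs_L2 hΩb _) (((integrable_abs_L2 hΩb u).const_mul _).add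
        ((integrable_abs_L2 hΩb v).const_mul _)) ?_
      filter_upwards [hcoe] with x hx
      rw [hx]
      refine (abs_add_le _ _).trans_eq ?_
      rw [abs_mul, abs_mul, abs_of_nonneg (sub_nonneg.2 ht1), abs_of_pos ht0]
    have hsm : toL2 ((t • z : H10 Ω) : H1 Ω) = t • toL2 (z : H1 Ω) := rfl
    rw [hsm, norm_smul, norm_smul, Real.norm_of_nonneg ht0.le, real_inner_smul_right] at hdiff
    have hβc := mul_le_mul_of_nonneg_left hconv hβ.le
    have : 0 ≤ t * (X + t * Y) := by
      rw [hX, hY]; nlinarith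
    exact nonneg_of_mul_nonneg_right this ht0
  have hlim : Filter.Tendsto (fun t : ℝ => X + t * Y) (nhdsWithin 0 (Set.Ioi 0)) (nhds X) := by
    have : Filter.Tendsto (fun t : ℝ => X + t * Y) (nhds 0) (nhds (X + 0 * Y)) :=
      (by fun_prop : Continuous fun t : ℝ => X + t * Y).tendsto 0
    simpa using this.mono_left nhdsWithin_le_nhds
  refine ge_of_tendsto hlim ?_
  filter_upwards [Ioc_mem_nhdsGT (zero_lt_one' ℝ)] with t ht using key t ht.1 ht.2

end EllipticControl

theorem theorem2p2 {n : ℕ} (hn : 1 ≤ n) {Ω : Set (EuclideanSpace ℝ (Fin n))}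
    (hΩ : IsOpen Ω) (hΩb : Bornology.IsBounded Ω)
    (A : Fin n → Fin n → EuclideanSpace ℝ (Fin n) → ℝ) (c₀ : EuclideanSpace ℝ (Fin n) → ℝ)
    (hL : UniformlyElliptic Ω A c₀) (y_d y_r : L2 Ω)
    {a b α β : ℝ} (ha : a ≤ 0) (hb : 0 ≤ b) (hα : 0 < α) (hβ : 0 < β)
    (y : H10 Ω) (u : L2 Ω) :
    IsOptimal A c₀ y_d y_r a b α β y u ↔
      ∃ p : H10 Ω,
        IsWeakSolution A c₀ (u + y_r) y ∧
        IsWeakSolution A c₀ (y_d - toL2 (y : H1 Ω)) p ∧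
        ∀ᵐ x ∂(volume.restrict Ω), u x = proj a b (1 / α * soft (toL2 (p : H1 Ω) x) β) := by
  constructor
  · intro hopt
    obtain ⟨p, hp⟩ := exists_isWeakSolution hn hΩb hL (y_d - toL2 (y : H1 Ω))
    refine ⟨p, hopt.1.1, hp, ?_⟩
    -- The thresholded control `v` and `u` both satisfy the variational inequality; testing each
    -- with the other and adding gives `-α ‖u - v‖² ≥ 0`.
    obtain ⟨v, hv, hvp⟩ := exists_admissible_eq_thresholding hΩb (ha.trans hb) α β
      (toL2 (p : H1 Ω))
    have h1 := hopt.variational_ineq hn hΩb hL hβ hp hv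
    have h2 := variational_ineq_of_eq_thresholding hΩb ha hb hα hβ hvp hopt.1.2
    have h3 : inner ℝ (α • u - toL2 (p : H1 Ω)) (v - u) +
        inner ℝ (α • v - toL2 (p : H1 Ω)) (u - v) = -(α * ‖u - v‖ ^ 2) := by
      rw [← neg_sub u v, inner_neg_right, neg_add_eq_sub, ← inner_sub_left,
        sub_sub_sub_cancel_right, ← smul_sub, real_inner_smul_left, ← neg_sub u v,
        inner_neg_left, real_inner_self_eq_norm_sq]
      ring
    have h4 : ‖u - v‖ ^ 2 ≤ 0 := by
      by_contra! h
      have := mul_pos hα h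
      linarith
    have huv : u = v := by
      rw [← sub_eq_zero, ← norm_eq_zero]
      exact (pow_eq_zero_iff two_ne_zero).1 (le_antisymm h4 (by positivity))
    rwa [huv]
  · rintro ⟨p, hy, hp, hu⟩
    have hadm : u ∈ admissible Ω a b := by
      filter_upwards [hu] with x hx
      rw [hx]
      exact proj_mem_Icc (ha.trans hb) _
    refine ⟨⟨hy, hadm⟩, ?_⟩
    rintro ⟨y', u'⟩ ⟨hy', hu'⟩
    have hz : IsWeakSolution A c₀ (u' - u) (y' - y) := by
      have := hy'.sub hL hy
      rwa [add_sub_add_right_eq_sub] at this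
    have h1 := cost_sub_cost hL α β (u := u) hp hz
    have h2 := variational_ineq_of_eq_thresholding hΩb ha hb hα hβ hu hu'
    rw [add_sub_cancel, add_sub_cancel] at h1
    have h3 : 0 ≤ 1 / 2 * ‖toL2 ((y' - y : H10 Ω) : H1 Ω)‖ ^ 2 + α / 2 * ‖u' - u‖ ^ 2 := by
      positivity
    show cost y_d α β (y, u) ≤ cost y_d α β (y', u')
    linarith
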